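/- Let $F:\mathbf{Set}\to\mathbf{Set}$ be a finitary functor (one preserving filtered colimits) with $F\emptyset\neq\emptyset$, and let $p\in F\emptyset$. Notation. Let $F^n0$ and $F^n1$ ($n\in\mathbb N$) be the initial-algebra and terminal-coalgebra $\omega$-chains, with colimit $i_n:F^n0\to F^\omega0$ and limit $t_n:F^\omega1\to F^n1$. With $u:0\to1$ the unique map, let $\bar u:F^\omega0\to F^\omega1$ be the unique map with $t_n\bar u\, i_n=F^nu$ for all $n$; viewing $p$ as a map $1\to F0$, put $r_n=\bar u\, i_{n+1}\,F^np\; t_n:F^\omega1\to F^\omega1$. Define on $F^\omega1$: $x\sqsubseteq y$ iff $x=y$ or $x=r_n(y)$ for some $n$. Let $\mu F=F^\omega0$ with the bijective structure $\varphi:F(\mu F)\to\mu F$, $\varphi\cdot Fi_n=i_{n+1}$. For a terminal coalgebra $(\nu F,\tau)$ let $m:\mu F\to\nu F$ be the unique coalgebra homomorphism from $(\mu F,\varphi^{-1})$, and let $j:\nu F\to F^\omega1$ be the canonical map, i.e. the one induced by the cone $c_n:\nu F\to F^n1$ with $c_{n+1}=Fc_n\cdot\tau$. A presentation of $F$ is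 a finitary signature $\Sigma$ with a natural transformation $\varepsilon:H_\Sigma\to F$ with surjective components, where $H_\Sigma X=\coprod_n\Sigma_n\times X^n$. Given a presentation and $p'\in\Sigma_0$ with $\varepsilon_\emptyset(p')=p$, let $\partial_n s$ be the finite tree obtained from a $\Sigma$-tree $s$ by cutting away all nodes of height larger than $n$ and labelling all nodes of height $n$ by $p'$. Let $\sim$ be the congruence on the algebra of finite $\Sigma$-trees generated by all equations between flat terms $a,b\in H_\Sigma X$ ($X$ a set of variables) with $\varepsilon_X(a)=\varepsilon_X(b)$, and put $s\sim^* s'$ iff $\partial_ns\sim\partial_ns'$ for all $n$. Let $[s]\in\nu F$ be the image of $s$ under the unique $F$-coalgebra homomorphism from the coalgebra of all $\Sigma$-trees (with structure tree-tupling followed by $\varepsilon$) to $\nu F$. The order by cutting on $\nu F$ is: $x\le y$ iff $x=y$, or there are a finite $\Sigma$-tree $s$, a $\Sigma$-tree $s'$ and $n\in\mathbb N$ with $x=[s]$, $y=[s']$ and $s\sim\partial_ns'$. A cpo is a poset with joins of (nonempty) directed sets, and a continuous map is one preserving all existing directed joins. A conservative completion of a poset $P$ is a cpo $\bar P$ containing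 $P$ as a subposet closed under existing directed joins, such that every continuous map from $P$ to a cpo has a unique continuous extension to $\bar P$. Theorem. $(\mu F,\varphi)$ is an initial algebra, a terminal coalgebra exists, and $F$ has a presentation. For every presentation $(\Sigma,\varepsilon)$, every $p'\in\Sigma_0$ with $\varepsilon_\emptyset(p')=p$ and every terminal coalgebra $(\nu F,\tau)$: 1. The map $s\mapsto[s]$ is surjective with kernel $\sim^*$. The relation $\sqsubseteq$ on $F^\omega1$ and the relation $\le$ on $\nu F$ are partial orders. The map $j$ is injective, and the order by cutting on $\nu F$ is the restriction of $\sqsubseteq$ along $j$: $x\le y\iff j(x)\sqsubseteq j(y)$. 2. $m$ is injective (so that $\mu F$ becomes a subposet of $\nu F$), $j\cdot m=\bar u$, and $F^\omega1$ is a conservative completion both of $\nu F$ (via $j$) and of its subposet $\mu F$ (via $\bar u$). In particular $\nu F$ and $\mu F$ have the same conservative completion. 3. Order $F(\nu F)$ and $F(\mu F)$ via the bijections $\tau$ and $\varphi$. Then $Fm$ embeds $F(\mu F)$ as a subposet of $F(\nu F)$, $\varphi^{-1}$ is continuous, and $\tau:\nu F\to F(\nu F)$ is continuous and is the unique continuous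 map extending $\varphi^{-1}$, i.e. the unique continuous $g$ with $g\cdot m=Fm\cdot\varphi^{-1}$. -/

import Mathlib

open CategoryTheory CategoryTheory.Limits CategoryTheory.Endofunctor

universe v u

noncomputable section

namespace CuttingOrder

/-! ### Complete partial orders and conservative completions -/

/-- A cpo: a poset in which every (nonempty) directed subset has a join. -/
def IsCpo (B : Type v) [PartialOrder B] : Prop :=
  ∀ D : Set B, D.Nonempty → DirectedOn (· ≤ ·) D → ∃ b, IsLUB D b

/-- `e : P → Q` exhibits the poset `Q` as a conservative completion of the poset `P`: `Q` is a cpo,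
`e` embeds `P` as a subposet closed under the directed joins existing in `P`, and every continuous
function from `P` to a cpo extends along `e` to a unique continuous function on `Q`.
Continuous means: preserving all existing directed joins. The cpo's range over the universe `v`. -/
structure IsConservativeCompletion {P Q : Type u} [PartialOrder P] [PartialOrder Q]
    (e : P → Q) : Prop where
  isCpo : IsCpo Q
  le_iff_le : ∀ x y : P, e x ≤ e y ↔ x ≤ y
  continuous : ScottContinuous e
  existsUnique_extension : ∀ (B : Type v) [PartialOrder B], IsCpo B →
    ∀ f : P → B, ScottContinuous f →
      ∃! g : Q → B, ScottContinuous g ∧ ∀ x : P, g (e x) = f x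

/-! ### The initial-algebra chain and the terminal-coalgebra chain up to `ω` -/

section Chains

variable (F : Type u ⥤ Type u)

/-- `F^n 0`. -/
def F0 : ℕ → Type u
  | 0 => PEmpty.{u + 1}
  | n + 1 => F.obj (F0 n)

/-- `F^n 1`. -/
def F1 : ℕ → Type u
  | 0 => PUnit.{u + 1}
  | n + 1 => F.obj (F1 n)

/-- The connecting morphism `F^n i : F^n 0 ⟶ F^(n+1) 0`, where `i : 0 ⟶ F 0` is unique. -/
def iMap : (n : ℕ) → (F0 F n ⟶ F0 F (n + 1))
  | 0 => ↾(fun x : PEmpty.{u + 1} => PEmpty.elim x)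
  | n + 1 => F.map (iMap n)

/-- The connecting morphism `F^n t : F^(n+1) 1 ⟶ F^n 1`, where `t : F 1 ⟶ 1` is unique. -/
def tMap : (n : ℕ) → (F1 F (n + 1) ⟶ F1 F n)
  | 0 => ↾(fun _ => PUnit.unit)
  | n + 1 => F.map (tMap n)

/-- `F^n u : F^n 0 ⟶ F^n 1`, where `u : 0 ⟶ 1` is unique. -/
def uMap : (n : ℕ) → (F0 F n ⟶ F1 F n)
  | 0 => ↾(fun _ => PUnit.unit)
  | n + 1 => F.map (uMap n)

/-- `F^n p : F^n 1 ⟶ F^(n+1) 0`, for a chosen element `p` of `F 0`. -/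
def pMap (p : F.obj PEmpty.{u + 1}) : (n : ℕ) → (F1 F n ⟶ F0 F (n + 1))
  | 0 => ↾(fun _ => p)
  | n + 1 => F.map (pMap p n)

/-- `F^ω 0`, the colimit of the initial-algebra `ω`-chain. -/
abbrev FOmega0 : Type u := colimit (Functor.ofSequence (iMap F))

/-- The colimit cocone `i_n : F^n 0 ⟶ F^ω 0`. -/
def iCocone (n : ℕ) : F0 F n ⟶ FOmega0 F := colimit.ι (Functor.ofSequence (iMap F)) n

/-- `F^ω 1`, the limit of the terminal-coalgebra `ω`-chain. -/
abbrev FOmega1 : Type u := limit (Functor.ofOpSequence (tMap F))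

/-- The limit cone `t_n : F^ω 1 ⟶ F^n 1`. -/
def tCone (n : ℕ) : FOmega1 F ⟶ F1 F n :=
  limit.π (Functor.ofOpSequence (tMap F)) (Opposite.op n)

theorem iMap_iCocone (n : ℕ) : iMap F n ≫ iCocone F (n + 1) = iCocone F n := by
  have h := colimit.w (Functor.ofSequence (iMap F)) (homOfLE (Nat.le_add_right n 1))
  rw [Functor.ofSequence_map_homOfLE_succ] at h
  exact h

theorem tCone_tMap (n : ℕ) : tCone F (n + 1) ≫ tMap F n = tCone F n := by
  have h := limit.w (Functor.ofOpSequence (tMap F)) (homOfLE (Nat.le_add_right n 1)).op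
  rw [Functor.ofOpSequence_map_homOfLE_succ] at h
  exact h

variable {F}

theorem FOmega0_hom_ext {X : Type u} {f g : FOmega0 F ⟶ X}
    (h : ∀ n, iCocone F n ≫ f = iCocone F n ≫ g) : f = g :=
  colimit.hom_ext h

theorem FOmega1_hom_ext {X : Type u} {f g : X ⟶ FOmega1 F}
    (h : ∀ n, f ≫ tCone F n = g ≫ tCone F n) : f = g :=
  limit.hom_ext fun n => h n.unop

/-- The morphism out of `F^ω 0` induced by a cocone of the initial-algebra `ω`-chain. -/
def descOmega0 {X : Type u} (c : ∀ n, F0 F n ⟶ X) (hc : ∀ n, iMap F n ≫ c (n + 1) = c n) :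
    FOmega0 F ⟶ X :=
  colimit.desc (Functor.ofSequence (iMap F))
    { pt := X
      ι := NatTrans.ofSequence c (fun n => by
        rw [Functor.ofSequence_map_homOfLE_succ]
        exact (hc n).trans (Category.comp_id _).symm) }

theorem iCocone_descOmega0 {X : Type u} (c : ∀ n, F0 F n ⟶ X)
    (hc : ∀ n, iMap F n ≫ c (n + 1) = c n) (n : ℕ) :
    iCocone F n ≫ descOmega0 c hc = c n :=
  colimit.ι_desc _ _

/-- The morphism into `F^ω 1` induced by a cone of the terminal-coalgebra `ω`-chain. -/
def liftOmega1 {X : Type u} (c : ∀ n, X ⟶ F1 F n) (hc : ∀ n, c (n + 1) ≫ tMap F n = c n) :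
    X ⟶ FOmega1 F :=
  limit.lift (Functor.ofOpSequence (tMap F))
    { pt := X
      π := NatTrans.ofOpSequence (F := (Functor.const ℕᵒᵖ).obj X) c (fun n => by
        rw [Functor.ofOpSequence_map_homOfLE_succ]
        exact (Category.id_comp _).trans (hc n).symm) }

theorem liftOmega1_tCone {X : Type u} (c : ∀ n, X ⟶ F1 F n)
    (hc : ∀ n, c (n + 1) ≫ tMap F n = c n) (n : ℕ) :
    liftOmega1 c hc ≫ tCone F n = c n :=
  limit.lift_π _ _

variable (F)

/-- The canonical morphisms `F^n 0 ⟶ F^k 1`. -/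
def cMap : (n k : ℕ) → (F0 F n ⟶ F1 F k)
  | 0, _ => ↾(fun x : PEmpty.{u + 1} => PEmpty.elim x)
  | _ + 1, 0 => ↾(fun _ => PUnit.unit)
  | n + 1, k + 1 => F.map (cMap n k)

theorem F0_zero_hom_ext {X : Type u} (f g : F0 F 0 ⟶ X) : f = g := by
  ext x
  exact PEmpty.elim x

theorem F1_zero_hom_ext {X : Type u} (f g : X ⟶ F1 F 0) : f = g := by
  ext x
  rfl

theorem cMap_tMap : ∀ n k, cMap F n (k + 1) ≫ tMap F k = cMap F n k
  | 0, _ => F0_zero_hom_ext F _ _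
  | _ + 1, 0 => F1_zero_hom_ext F _ _
  | n + 1, k + 1 => by
    change F.map (cMap F n (k + 1)) ≫ F.map (tMap F k) = F.map (cMap F n k)
    rw [← F.map_comp, cMap_tMap n k]

theorem iMap_cMap : ∀ n k, iMap F n ≫ cMap F (n + 1) k = cMap F n k
  | 0, _ => F0_zero_hom_ext F _ _
  | _ + 1, 0 => F1_zero_hom_ext F _ _
  | n + 1, k + 1 => by
    change F.map (iMap F n) ≫ F.map (cMap F (n + 1) k) = F.map (cMap F n k)
    rw [← F.map_comp, iMap_cMap n k]

theorem cMap_self : ∀ n, cMap F n n = uMap F n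
  | 0 => F0_zero_hom_ext F _ _
  | n + 1 => by
    change F.map (cMap F n n) = F.map (uMap F n)
    rw [cMap_self n]

theorem cMap_unique (v : FOmega0 F ⟶ FOmega1 F)
    (hv : ∀ n, iCocone F n ≫ v ≫ tCone F n = uMap F n) (n k : ℕ) :
    iCocone F n ≫ v ≫ tCone F k = cMap F n k := by
  rcases le_total n k with h | h
  · obtain ⟨d, rfl⟩ := Nat.exists_eq_add_of_le h
    clear h
    induction d generalizing n with
    | zero => rw [Nat.add_zero, hv, cMap_self]
    | succ d ih =>
      have h2 := ih (n + 1)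
      rw [show n + 1 + d = n + (d + 1) by omega] at h2
      rw [← iMap_iCocone F n, Category.assoc, h2, iMap_cMap]
  · obtain ⟨d, rfl⟩ := Nat.exists_eq_add_of_le h
    clear h
    induction d generalizing k with
    | zero => rw [Nat.add_zero, hv, cMap_self]
    | succ d ih =>
      have h2 := ih (k + 1)
      rw [show k + 1 + d = k + (d + 1) by omega] at h2
      have h3 : v ≫ tCone F k = (v ≫ tCone F (k + 1)) ≫ tMap F k := by
        rw [Category.assoc, tCone_tMap]
      rw [h3, ← Category.assoc, h2, cMap_tMap]

theorem existsUnique_uBar :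
    ∃! v : FOmega0 F ⟶ FOmega1 F, ∀ n, iCocone F n ≫ v ≫ tCone F n = uMap F n := by
  refine ⟨descOmega0 (fun n => liftOmega1 (cMap F n) (cMap_tMap F n)) ?_, ?_, ?_⟩
  · intro n
    refine FOmega1_hom_ext fun k => ?_
    rw [Category.assoc, liftOmega1_tCone, liftOmega1_tCone, iMap_cMap]
  · intro n
    rw [← Category.assoc, iCocone_descOmega0, liftOmega1_tCone, cMap_self]
  · intro v hv
    refine FOmega0_hom_ext fun n => FOmega1_hom_ext fun k => ?_
    rw [iCocone_descOmega0, liftOmega1_tCone, Category.assoc, cMap_unique F v hv]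

/-- The unique morphism `ū : F^ω 0 ⟶ F^ω 1` with `t_n ∘ ū ∘ i_n = F^n u` for all `n`. -/
def uBar : FOmega0 F ⟶ FOmega1 F := (existsUnique_uBar F).choose

/-- `r_n = ū ∘ i_(n+1) ∘ F^n p ∘ t_n : F^ω 1 ⟶ F^ω 1`. -/
def rMap (p : F.obj PEmpty.{u + 1}) (n : ℕ) : FOmega1 F ⟶ FOmega1 F :=
  tCone F n ≫ pMap F p n ≫ iCocone F (n + 1) ≫ uBar F

/-- The relation `x ⊑ y` on `F^ω 1`: `x = y` or `x = r_n(y)` for some `n`. -/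
def ChainLE (p : F.obj PEmpty.{u + 1}) (x y : FOmega1 F) : Prop :=
  x = y ∨ ∃ n, x = rMap F p n y

end Chains

/-! ### The initial algebra `μF = F^ω 0` of a finitary functor -/

section Mu

variable (F : Type u ⥤ Type u)

instance [PreservesFilteredColimits F] : PreservesColimitsOfShape ℕ F :=
  (preservesSmallestFilteredColimits_of_preservesFilteredColimits F).preserves_filtered_colimits ℕ

/-- The cocone `i_(n+1) : F(F^n 0) ⟶ F^ω 0`. -/
def shiftCocone : Cocone (Functor.ofSequence (iMap F) ⋙ F) where
  pt := FOmega0 F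
  ι := NatTrans.ofSequence (fun n => iCocone F (n + 1)) (fun n => by
    rw [Functor.comp_map, Functor.ofSequence_map_homOfLE_succ]
    exact (iMap_iCocone F (n + 1)).trans (Category.comp_id _).symm)

/-- The legs of the inverse of `φ`. -/
def phiInvLeg : (n : ℕ) → (F0 F n ⟶ F.obj (FOmega0 F))
  | 0 => ↾(fun x : PEmpty.{u + 1} => PEmpty.elim x)
  | n + 1 => F.map (iCocone F n)

theorem iMap_phiInvLeg : ∀ n, iMap F n ≫ phiInvLeg F (n + 1) = phiInvLeg F n
  | 0 => F0_zero_hom_ext F _ _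
  | n + 1 => by
    change F.map (iMap F n) ≫ F.map (iCocone F (n + 1)) = F.map (iCocone F n)
    rw [← F.map_comp, iMap_iCocone]

variable [PreservesFilteredColimits F]

/-- The algebra structure `φ : F(F^ω 0) ⟶ F^ω 0`, determined by `φ ∘ F(i_n) = i_(n+1)`. -/
def phiHom : F.obj (FOmega0 F) ⟶ FOmega0 F :=
  (isColimitOfPreserves F (colimit.isColimit (Functor.ofSequence (iMap F)))).desc (shiftCocone F)

theorem map_iCocone_phiHom (n : ℕ) : F.map (iCocone F n) ≫ phiHom F = iCocone F (n + 1) :=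
  (isColimitOfPreserves F (colimit.isColimit (Functor.ofSequence (iMap F)))).fac (shiftCocone F) n

/-- The isomorphism `φ : F(F^ω 0) ≅ F^ω 0`. -/
def phi : F.obj (FOmega0 F) ≅ FOmega0 F where
  hom := phiHom F
  inv := descOmega0 (phiInvLeg F) (iMap_phiInvLeg F)
  hom_inv_id := by
    refine (isColimitOfPreserves F
      (colimit.isColimit (Functor.ofSequence (iMap F)))).hom_ext fun n => ?_
    change F.map (iCocone F n) ≫ _ = F.map (iCocone F n) ≫ _
    rw [← Category.assoc, map_iCocone_phiHom]
    have h : iCocone F (n + 1) ≫ descOmega0 (phiInvLeg F) (iMap_phiInvLeg F) =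
        F.map (iCocone F n) := iCocone_descOmega0 _ _ (n + 1)
    exact h.trans (Category.comp_id _).symm
  inv_hom_id := by
    refine FOmega0_hom_ext fun n => ?_
    rw [← Category.assoc, iCocone_descOmega0]
    cases n with
    | zero => exact F0_zero_hom_ext F _ _
    | succ n => exact (map_iCocone_phiHom F n).trans (Category.comp_id _).symm

/-- The initial algebra `μF`, carried by `F^ω 0` with structure `φ`. -/
def muAlg : Algebra F := ⟨FOmega0 F, (phi F).hom⟩

/-- `μF` as a coalgebra, with structure `φ⁻¹`. -/
def muCoalg : Coalgebra F := ⟨FOmega0 F, (phi F).inv⟩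

end Mu

/-! ### Terminal coalgebras `νF` -/

section Nu

variable {F : Type u ⥤ Type u}

/-- The canonical morphisms from a coalgebra to `F^n 1`. -/
def coalgCone (C : Coalgebra F) : (n : ℕ) → (C.V ⟶ F1 F n)
  | 0 => ↾(fun _ => PUnit.unit)
  | n + 1 => C.str ≫ F.map (coalgCone C n)

theorem coalgCone_tMap (C : Coalgebra F) :
    ∀ n, coalgCone C (n + 1) ≫ tMap F n = coalgCone C n
  | 0 => F1_zero_hom_ext F _ _
  | n + 1 => by
    change (C.str ≫ F.map (coalgCone C (n + 1))) ≫ F.map (tMap F n) =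
      C.str ≫ F.map (coalgCone C n)
    rw [Category.assoc, ← F.map_comp, coalgCone_tMap C n]

/-- The canonical map from a coalgebra `C` to `F^ω 1`. For `C = νF = F^(ω+ω) 1` it is the
connecting morphism `F^(ω+ω) 1 ⟶ F^ω 1` of the terminal-coalgebra chain. -/
def toOmega1 (C : Coalgebra F) : C.V ⟶ FOmega1 F :=
  liftOmega1 (coalgCone C) (coalgCone_tMap C)

/-- The unique coalgebra homomorphism `m : μF ⟶ νF`. -/
def mMap [PreservesFilteredColimits F] {C : Coalgebra F} (hC : IsTerminal C) :
    FOmega0 F ⟶ C.V :=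
  (hC.from (muCoalg F)).f

end Nu

/-! ### Signatures, trees, presentations and the order by cutting -/

section Trees

/-- The polynomial functor of a finitary signature `S`, as a `PFunctor`: shapes are the operation
symbols, positions of an `n`-ary symbol are the elements of `Fin n`. -/
def sigP (S : ℕ → Type u) : PFunctor.{u, 0} := ⟨Σ n, S n, fun a => Fin a.1⟩

/-- The polynomial functor `H_S X = ∐ n, S n × X ^ n`. -/
def polyFunctor (S : ℕ → Type u) : Type u ⥤ Type u where
  obj X := (sigP S).Obj X
  map f := ↾((sigP S).map f)

/-- All `S`-trees (the terminal coalgebra of `H_S`). -/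
abbrev STree (S : ℕ → Type u) : Type u := (sigP S).M

/-- The finite `S`-trees (the initial algebra of `H_S`). -/
abbrev FinTree (S : ℕ → Type u) : Type u := (sigP S).W

variable {S : ℕ → Type u}

/-- A finite tree regarded as a tree. -/
def FinTree.toTree : FinTree S → STree S
  | ⟨a, f⟩ => PFunctor.M.mk ⟨a, fun i => FinTree.toTree (f i)⟩

/-- The flat term consisting of a nullary symbol. -/
def constTerm (p' : S 0) (X : Type u) : (sigP S).Obj X := ⟨⟨0, p'⟩, fun i => Fin.elim0 i⟩

/-- The cutting `∂_n t`: all nodes of height larger than `n` are cut away, and the nodes of height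
`n` become leaves labelled by `p'`. -/
def cut (p' : S 0) : ℕ → STree S → FinTree S
  | 0, _ => PFunctor.W.mk (constTerm p' _)
  | n + 1, t => PFunctor.W.mk ⟨t.dest.1, fun i => cut p' n (t.dest.2 i)⟩

variable {F : Type u ⥤ Type u}

/-- The relation `∼` on finite trees, the congruence generated by the `ε`-equations. An
`ε`-equation is an equation `a = b` between flat terms over a set `X` of variables with
`ε_X a = ε_X b`. -/
inductive EpsEq (ε : polyFunctor S ⟶ F) : FinTree S → FinTree S → Prop
  | eqn (X : Type u) (a b : (sigP S).Obj X) (h : ε.app X a = ε.app X b) (f : X → FinTree S) :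
      EpsEq ε (PFunctor.W.mk ((sigP S).map f a)) (PFunctor.W.mk ((sigP S).map f b))
  | congr (a : (sigP S).A) (f g : (sigP S).B a → FinTree S) (h : ∀ i, EpsEq ε (f i) (g i)) :
      EpsEq ε (PFunctor.W.mk ⟨a, f⟩) (PFunctor.W.mk ⟨a, g⟩)
  | refl (s : FinTree S) : EpsEq ε s s
  | symm {s t : FinTree S} : EpsEq ε s t → EpsEq ε t s
  | trans {s t r : FinTree S} : EpsEq ε s t → EpsEq ε t r → EpsEq ε s r

/-- The relation `∼*` on trees: `∂_n s ∼ ∂_n s'` for all `n`. -/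
def EpsEqStar (ε : polyFunctor S ⟶ F) (p' : S 0) (s s' : STree S) : Prop :=
  ∀ n, EpsEq ε (cut p' n s) (cut p' n s')

/-- The `F`-coalgebra of all `S`-trees, with structure tree-tupling followed by `ε`. -/
def treeCoalg (ε : polyFunctor S ⟶ F) : Coalgebra F where
  V := STree S
  str := (↾(PFunctor.M.dest : STree S → (sigP S).Obj (STree S))) ≫ ε.app (STree S)

/-- The coalgebra homomorphism `k̂` from the trees to the terminal coalgebra `νF`; it is the quotient
map by `∼*`. -/
def kHat (ε : polyFunctor S ⟶ F) {C : Coalgebra F} (hC : IsTerminal C) : STree S ⟶ C.V :=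
  (hC.from (treeCoalg ε)).f

/-- The order by cutting on `νF = (trees)/∼*`: `x ≤ y` iff `x = y`, or `x = [s]` and `y = [s']`
with `s ∼ ∂_n s'` for some `n`. -/
def CutLE (ε : polyFunctor S ⟶ F) (p' : S 0) {C : Coalgebra F} (hC : IsTerminal C)
    (x y : C.V) : Prop :=
  x = y ∨ ∃ (s : FinTree S) (s' : STree S) (n : ℕ),
    kHat ε hC s.toTree = x ∧ kHat ε hC s' = y ∧ EpsEq ε s (cut p' n s')

/-- A presentation of `F` by the signature `S`: a natural transformation `H_S ⟶ F` with surjective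
components. -/
def IsPresentation (ε : polyFunctor S ⟶ F) : Prop :=
  ∀ X : Type u, Function.Surjective (ε.app X)

end Trees

end CuttingOrder

end

open CuttingOrder

/-! Everything takes place in `F^ω 1`, whose elements are the coherent sequences
`(x_n)` with `x_n` in `F^n 1`. The map `r_n` keeps the components up to `n` and fills the rest with
the default element `p`; hence `r_n ∘ r_m = r_(min n m)`, an element is determined by its
truncations `r_n x`, and every coherent sequence of truncations comes from an element (`isTruncation_rMap`).

The order theory uses these three facts only. In the order "is a truncation of", lower sets are
chains, and a directed set without a greatest element has exactly one upper bound `y`, and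
each `r_n y` lies below an element of the set (`directed_cases`). So every element is the join of
the chain of its truncations, and `F^ω 1` is a conservative completion of any subposet that contains
all `r_n x`: a continuous map `f` extends by `x ↦ ⨆ n, f (r_n x)`
(`isConservativeCompletion_of_trunc`), and continuous maps agreeing on the truncations are equal
(`scottContinuous_ext`).

It remains to see `μF` and `νF` as such subposets. Since `p ∘ u` is the unique morphism `0 ⟶ F 0`,
the composite `F^n p ∘ F^n u` is the connecting morphism of the initial chain, so that `i_n a` can
be recovered from `ū (i_n a)` and `ū` is injective (`uBar_injective`), with all `r_n x` in its image by
definition. The map `j : νF ⟶ F^ω 1` is injective because `F` is finitary: elements of `F (F^ω 1)`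
live on finite subsets, which embed in some `F^n 1`, so the kernel of `j` is a congruence and
terminality makes it trivial (`toOmega1_injective`).

The passage to trees is made by evaluating finite trees in the initial algebra: `∼` is the kernel of
evaluation (`epsEq_iff_evalFin_eq`), and cutting at height `n` becomes `r_n` (`uBar_evalFin_cut`).
Hence `∼*` is the kernel of `s ↦ [s]`, and the order by cutting is the order of `F^ω 1`
(`kHat_eq_iff`, `cutLE_iff_chainLE`). A terminal coalgebra exists as the `QPF.Cofix` of a
presentation. -/

noncomputable section

namespace CuttingOrder

/-! ### Posets ordered by truncation -/

section Truncation

/-- A commuting family of idempotents `r n` on `X` that behaves like truncation of sequences at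
level `n`: the elements of `X` are exactly the sequences that are coherent under truncation. -/
structure IsTruncation {X : Type u} (r : ℕ → X → X) : Prop where
  comp : ∀ n m x, r n (r m x) = r (min n m) x
  ext : ∀ x y, (∀ n, r n x = r n y) → x = y
  complete : ∀ s : ℕ → X, (∀ n, r n (s (n + 1)) = s n) → ∃ x, ∀ n, r n x = s n

variable {X : Type u} {r : ℕ → X → X}

theorem IsTruncation.comp_of_le (hr : IsTruncation r) {n m : ℕ} (h : n ≤ m) (x : X) :
    r n (r m x) = r n x := by
  rw [hr.comp, min_eq_left h]

theorem IsTruncation.comp_of_ge (hr : IsTruncation r) {n m : ℕ} (h : m ≤ n) (x : X) :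
    r n (r m x) = r m x := by
  rw [hr.comp, min_eq_right h]

/-- The order `x ≤ y` iff `x = y` or `x` is a truncation of `y`. -/
abbrev IsTruncation.partialOrder (hr : IsTruncation r) : PartialOrder X where
  le x y := x = y ∨ ∃ n, x = r n y
  le_refl x := Or.inl rfl
  le_trans := by
    rintro x y z (rfl | ⟨n, rfl⟩) (rfl | ⟨m, rfl⟩)
    · exact Or.inl rfl
    · exact Or.inr ⟨m, rfl⟩
    · exact Or.inr ⟨n, rfl⟩
    · exact Or.inr ⟨_, hr.comp n m z⟩
  le_antisymm := by
    rintro x y (h | ⟨n, hn⟩) (h' | ⟨m, hm⟩)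
    · exact h
    · exact h
    · exact h'.symm
    · rcases le_total n m with h | h
      · have := hr.comp_of_ge h y
        rw [← hn, ← hm] at this
        exact this.symm
      · have := hr.comp_of_ge h x
        rw [← hm, ← hn] at this
        exact this

variable [PartialOrder X] (hr : IsTruncation r) (hle : ∀ x y : X, x ≤ y ↔ x = y ∨ ∃ n, x = r n y)
include hle

theorem trunc_le (n : ℕ) (x : X) : r n x ≤ x := (hle _ _).2 (Or.inr ⟨n, rfl⟩)

include hr

theorem trunc_mono (x : X) : Monotone fun n => r n x := fun n m h => by
  have := trunc_le hle n (r m x)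
  rwa [hr.comp_of_le h] at this

/-- A directed set without greatest element has, for every `n`, an element that determines the
`n`-th truncation of all elements above it. Indeed, in a strictly increasing sequence in which each
element is a truncation of the next, the levels of truncation strictly increase. -/
theorem exists_stable {D : Set X} (hne : D.Nonempty) (hD : DirectedOn (· ≤ ·) D)
    (hmax : ¬ ∃ d, IsGreatest D d) (n : ℕ) : ∃ d ∈ D, ∀ z, d ≤ z → r n z = r n d := by
  have hstrict : ∀ d ∈ D, ∃ d' ∈ D, d ≠ d' ∧ ∃ k, d = r k d' := by
    intro d hd
    by_contra! hcon
    refine hmax ⟨d, hd, fun e he => ?_⟩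
    obtain ⟨c, hc, hdc, hec⟩ := hD d hd e he
    rcases (hle _ _).1 hdc with rfl | ⟨k, hk⟩
    · exact hec
    · by_cases hd' : d = c
      · rw [hd']
        exact hec
      · exact absurd hk (hcon c hc hd' k)
  have key : ∃ d ∈ D, ∀ z k, d = r k z → d ≠ z → n ≤ k := by
    induction n with
    | zero => exact ⟨hne.some, hne.some_mem, fun _ _ _ _ => Nat.zero_le _⟩
    | succ n ih =>
      obtain ⟨d, hd, h⟩ := ih
      obtain ⟨d', hd', hne', k, hk⟩ := hstrict d hd
      have hnk := h d' k hk hne'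
      refine ⟨d', hd', fun z j hj _ => ?_⟩
      by_contra hjn
      apply hne'
      rw [hk]
      nth_rw 1 [hj]
      rw [hr.comp_of_ge (by omega), ← hj]
  obtain ⟨d, hd, h⟩ := key
  refine ⟨d, hd, fun z hz => ?_⟩
  by_cases hdz : d = z
  · rw [hdz]
  · obtain ⟨k, hk⟩ := ((hle _ _).1 hz).resolve_left hdz
    rw [hk, hr.comp_of_le (h z k hk hdz)]

/-- The dichotomy for directed sets: either there is a greatest element, or there is exactly one
upper bound, and every truncation `r n y` of it lies below an element of the set. -/
theorem directed_cases {D : Set X} (hne : D.Nonempty) (hD : DirectedOn (· ≤ ·) D) :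
    (∃ d, IsGreatest D d) ∨ ∃ y, upperBounds D = {y} ∧ ∀ n, ∃ d ∈ D, r n y ≤ d := by
  refine or_iff_not_imp_left.2 fun hmax => ?_
  choose d hd hs using exists_stable hr hle hne hD hmax
  obtain ⟨y, hy⟩ := hr.complete (fun n => r n (d n)) (fun n => by
    obtain ⟨c, -, h1, h2⟩ := hD _ (hd n) _ (hd (n + 1))
    rw [← hs n c h1, ← hs (n + 1) c h2, hr.comp_of_le n.le_succ])
  refine ⟨y, ?_, fun n => ⟨d n, hd n, by rw [hy]; exact trunc_le hle _ _⟩⟩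
  ext z
  constructor
  · intro hz
    refine hr.ext _ _ fun n => ?_
    rw [hy, hs n z (hz (hd n))]
  · rintro rfl x hx
    obtain ⟨x', hx', hnot⟩ : ∃ x' ∈ D, ¬ x' ≤ x := by
      by_contra! h
      exact hmax ⟨x, hx, h⟩
    obtain ⟨c, hc, hxc, hx'c⟩ := hD x hx x' hx'
    obtain ⟨k, hk⟩ := ((hle _ _).1 hxc).resolve_left (fun h => hnot (h ▸ hx'c))
    obtain ⟨e, -, hce, hde⟩ := hD c hc _ (hd k)
    have hek : r k e = r k z := by rw [hs k e hde, hy]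
    rcases (hle _ _).1 hce with rfl | ⟨j, hj⟩
    · rw [hk, hek]
      exact trunc_le hle _ _
    · rw [hk, hj, hr.comp, ← hr.comp_of_le (min_le_left k j), hek,
        hr.comp_of_le (min_le_left k j)]
      exact trunc_le hle _ _

theorem isCpo_of_isTruncation : IsCpo X := by
  intro D hne hD
  rcases directed_cases hr hle hne hD with ⟨d, hd⟩ | ⟨y, hy, -⟩
  · exact ⟨d, hd.isLUB⟩
  · exact ⟨y, hy ▸ Set.mem_singleton y, fun z hz => (hy ▸ hz : z ∈ ({y} : Set X)).symm.le⟩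

theorem isLUB_range_trunc (x : X) : IsLUB (Set.range fun n => r n x) x := by
  have hub : x ∈ upperBounds (Set.range fun n => r n x) := by
    rintro _ ⟨n, rfl⟩
    exact trunc_le hle n x
  rcases directed_cases hr hle (Set.range_nonempty _)
    (directedOn_range.2 (trunc_mono hr hle x).directed_le) with ⟨d, ⟨k, rfl⟩, hk⟩ | ⟨y, hy, -⟩
  · have hx : x = r k x := hr.ext _ _ fun n => by
      rcases le_total n k with h | h
      · rw [hr.comp_of_le h]
      · rw [hr.comp_of_ge h]
        exact le_antisymm (hk ⟨n, rfl⟩) (trunc_mono hr hle x h)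
    exact IsGreatest.isLUB ⟨⟨k, hx.symm⟩, hub⟩
  · refine ⟨hub, fun z hz => ?_⟩
    rw [hy] at hub hz
    rw [hub, hz]

variable {P : Type u} [PartialOrder P] {e : P → X} (he : ∀ x y, e x ≤ e y ↔ x ≤ y)
include he

/-- Every element of a subposet of `X` is the join of any chain in the subposet whose elements are
its truncations. -/
theorem isLUB_range_of_trunc {x : P} {a : ℕ → P} (ha : ∀ n, e (a n) = r n (e x)) :
    Monotone a ∧ IsLUB (Set.range a) x := by
  refine ⟨fun n m h => ?_, ?_, fun z hz => ?_⟩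
  · rw [← he, ha, ha]
    exact trunc_mono hr hle _ h
  · rintro _ ⟨n, rfl⟩
    rw [← he, ha]
    exact trunc_le hle _ _
  · rw [← he]
    refine (isLUB_range_trunc hr hle (e x)).2 ?_
    rintro _ ⟨n, rfl⟩
    dsimp only
    rw [← ha, he]
    exact hz ⟨n, rfl⟩

/-- A Scott continuous map on a subposet of `X` is determined by its values on any subset containing
all truncations `r n x`. -/
theorem scottContinuous_ext {M : Type u} {k : M → P} (hk : ∀ n x, ∃ a, e (k a) = r n x)
    {B : Type v} [PartialOrder B] {g g' : P → B} (hg : ScottContinuous g)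
    (hg' : ScottContinuous g') (h : ∀ a, g (k a) = g' (k a)) : g = g' := by
  funext x
  choose a ha using fun n => hk n (e x)
  obtain ⟨hmono, hlub⟩ := isLUB_range_of_trunc hr hle he (a := fun n => k (a n)) ha
  have hdir := directedOn_range.2 hmono.directed_le
  have h1 := hg (Set.range_nonempty _) hdir hlub
  have h2 := hg' (Set.range_nonempty _) hdir hlub
  rw [← Set.range_comp] at h1 h2
  have h3 : (g ∘ fun n => k (a n)) = g' ∘ fun n => k (a n) := funext fun n => h (a n)
  rw [h3] at h1
  exact h1.unique h2

/-- `X` is a conservative completion of every subposet containing all truncations `r n x`. The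
continuous extension of `f` sends `x` to the join of the values of `f` at the truncations of `x`. -/
theorem isConservativeCompletion_of_trunc (hP : ∀ n x, ∃ a, e a = r n x) :
    IsConservativeCompletion.{v} e where
  isCpo := isCpo_of_isTruncation hr hle
  le_iff_le := he
  continuous := by
    intro D hne hD a ha
    have hmono : Monotone e := fun x y h => (he x y).2 h
    have hub : e a ∈ upperBounds (e '' D) := hmono.mem_upperBounds_image ha.1
    have hDe : DirectedOn (· ≤ ·) (e '' D) := by
      rintro _ ⟨x, hx, rfl⟩ _ ⟨y, hy, rfl⟩
      obtain ⟨z, hz, h1, h2⟩ := hD x hx y hy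
      exact ⟨e z, ⟨z, hz, rfl⟩, hmono h1, hmono h2⟩
    rcases directed_cases hr hle (hne.image e) hDe with ⟨_, ⟨d, hd, rfl⟩, hdm⟩ | ⟨y, hy, -⟩
    · have had : a ≤ d := ha.2 fun x hx => (he _ _).1 (hdm ⟨x, hx, rfl⟩)
      exact ⟨hub, fun z hz => (hmono had).trans (hz ⟨d, hd, rfl⟩)⟩
    · refine ⟨hub, fun z hz => ?_⟩
      rw [hy] at hub hz
      rw [hub, hz]
  existsUnique_extension := by
    intro B _ hB f hf
    choose a ha using fun x n => hP n x
    have hmono : ∀ x, Monotone (a x) := fun x n m h => by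
      rw [← he, ha, ha]
      exact trunc_mono hr hle _ h
    have hfm : ∀ x, Monotone fun n => f (a x n) := fun x => hf.monotone.comp (hmono x)
    choose g hg using fun x => hB (Set.range fun n => f (a x n)) (Set.range_nonempty _)
      (directedOn_range.2 (hfm x).directed_le)
    have hge : ∀ x, g (e x) = f x := fun x => by
      obtain ⟨h1, h2⟩ := isLUB_range_of_trunc hr hle he (ha (e x))
      have h3 := hf (Set.range_nonempty _) (directedOn_range.2 h1.directed_le) h2
      rw [← Set.range_comp] at h3
      exact (hg (e x)).unique h3
    have hgm : Monotone g := fun x y hxy => by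
      refine (hg x).2 ?_
      rintro _ ⟨n, rfl⟩
      rcases (hle _ _).1 hxy with rfl | ⟨k, rfl⟩
      · exact (hg x).1 ⟨n, rfl⟩
      · refine (hf.monotone ?_).trans ((hg y).1 ⟨n, rfl⟩)
        rw [← he, ha, ha, hr.comp]
        exact trunc_mono hr hle y (min_le_left _ _)
    have hgc : ScottContinuous g := by
      intro D hne hD x hx
      refine ⟨hgm.mem_upperBounds_image hx.1, fun b hb => ?_⟩
      rcases directed_cases hr hle hne hD with ⟨d, hd⟩ | ⟨y, hy, hyD⟩
      · rw [hx.unique hd.isLUB]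
        exact hb ⟨d, hd.1, rfl⟩
      · obtain rfl : x = y := by
          have h1 := hx.1
          rwa [hy] at h1
        refine (hg x).2 ?_
        rintro _ ⟨n, rfl⟩
        obtain ⟨d, hd, hnd⟩ := hyD n
        dsimp only
        rw [← hge, ha]
        exact (hgm hnd).trans (hb ⟨d, hd, rfl⟩)
    refine ⟨g, ⟨hgc, hge⟩, fun g' hg' => ?_⟩
    exact scottContinuous_ext hr hle (e := id) (fun _ _ => Iff.rfl) (k := e) hP hg'.1 hgc
      fun x => (hg'.2 x).trans (hge x).symm

end Truncation

theorem scottContinuous_of_equiv {A B : Type u} [PartialOrder A] [PartialOrder B] (f : A ≃ B)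
    (h : ∀ x y, x ≤ y ↔ f.symm x ≤ f.symm y) : ScottContinuous f := by
  intro D _ _ a ha
  let e : A ≃o B := ⟨f, by intro x y; rw [h, f.symm_apply_apply, f.symm_apply_apply]⟩
  exact (e.isLUB_image').2 ha

/-! ### The maps `r_n` as truncations of `F^ω 1` -/

section Chains

variable (F : Type u ⥤ Type u) (p : F.obj PEmpty.{u + 1})

theorem iCocone_uBar_tCone (n k : ℕ) : iCocone F n ≫ uBar F ≫ tCone F k = cMap F n k :=
  cMap_unique F _ (existsUnique_uBar F).choose_spec.1 n k

/-- Since `p ∘ u : 0 ⟶ F 0` is the unique morphism, `F^n p ∘ F^n u` is the connecting morphism of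
the initial-algebra chain, even if `F` does not preserve monomorphisms with empty domain. -/
theorem uMap_pMap : ∀ n, uMap F n ≫ pMap F p n = iMap F n
  | 0 => F0_zero_hom_ext F _ _
  | n + 1 => by
    change F.map (uMap F n) ≫ F.map (pMap F p n) = F.map (iMap F n)
    rw [← F.map_comp, uMap_pMap n]

theorem pMap_cMap : ∀ n, pMap F p n ≫ cMap F (n + 1) n = 𝟙 (F1 F n)
  | 0 => F1_zero_hom_ext F _ _
  | n + 1 => by
    change F.map (pMap F p n) ≫ F.map (cMap F (n + 1) n) = 𝟙 (F.obj (F1 F n))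
    rw [← F.map_comp, pMap_cMap n, F.map_id]

theorem rMap_tCone {n m : ℕ} (h : n ≤ m) : rMap F p m ≫ tCone F n = tCone F n := by
  induction h using Nat.decreasingInduction with
  | self => simp only [rMap, Category.assoc, iCocone_uBar_tCone, pMap_cMap, Category.comp_id]
  | of_succ n hn ih => rw [← tCone_tMap, ← Category.assoc, ih]

theorem iCocone_uBar_rMap {n m : ℕ} (h : n ≤ m) :
    iCocone F n ≫ uBar F ≫ rMap F p m = iCocone F n ≫ uBar F := by
  induction h using Nat.decreasingInduction with
  | self =>
    rw [rMap, ← Category.assoc, ← Category.assoc, Category.assoc (iCocone F m), iCocone_uBar_tCone,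
      cMap_self, ← Category.assoc, uMap_pMap, ← Category.assoc, iMap_iCocone]
  | of_succ n hn ih =>
    rw [← iMap_iCocone, Category.assoc, ih, Category.assoc]

variable {F}

theorem FOmega1_ext {x y : FOmega1 F} (h : ∀ n, tCone F n x = tCone F n y) : x = y := by
  have h1 : (↾(fun _ : PUnit.{u + 1} => x)) = ↾(fun _ : PUnit.{u + 1} => y) :=
    FOmega1_hom_ext fun n => by
      ext
      exact h n
  exact ConcreteCategory.congr_hom h1 PUnit.unit

theorem tCone_rMap_apply {n m : ℕ} (h : n ≤ m) (x : FOmega1 F) :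
    tCone F n (rMap F p m x) = tCone F n x :=
  ConcreteCategory.congr_hom (rMap_tCone F p h) x

theorem rMap_eq_of_tCone_eq {n : ℕ} {x y : FOmega1 F} (h : tCone F n x = tCone F n y) :
    rMap F p n x = rMap F p n y :=
  congrArg (pMap F p n ≫ iCocone F (n + 1) ≫ uBar F) h

theorem rMap_eq_iff {n : ℕ} {x y : FOmega1 F} :
    rMap F p n x = rMap F p n y ↔ tCone F n x = tCone F n y := by
  refine ⟨fun h => ?_, rMap_eq_of_tCone_eq p⟩
  rw [← tCone_rMap_apply p le_rfl x, h, tCone_rMap_apply p le_rfl y]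

theorem rMap_comp (n m : ℕ) (x : FOmega1 F) :
    rMap F p n (rMap F p m x) = rMap F p (min n m) x := by
  rcases le_or_gt n m with h | h
  · rw [min_eq_left h]
    exact rMap_eq_of_tCone_eq p (tCone_rMap_apply p h x)
  · rw [min_eq_right h.le]
    exact ConcreteCategory.congr_hom (iCocone_uBar_rMap F p h) (pMap F p m (tCone F m x))

variable (F) in
theorem isTruncation_rMap : IsTruncation fun n x => rMap F p n x where
  comp := rMap_comp p
  ext x y h := FOmega1_ext fun n => (rMap_eq_iff p).1 (h n)
  complete s hs := by
    let c (n : ℕ) : PUnit.{u + 1} ⟶ F1 F n := ↾(fun _ => tCone F n (s n))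
    have hc : ∀ n, c (n + 1) ≫ tMap F n = c n := fun n => by
      ext
      have h := ConcreteCategory.congr_hom (tCone_tMap F n) (s (n + 1))
      refine h.trans ?_
      change _ = tCone F n (s n)
      rw [← hs n, tCone_rMap_apply p le_rfl]
    refine ⟨liftOmega1 c hc PUnit.unit, fun n => ?_⟩
    have h : tCone F n (liftOmega1 c hc PUnit.unit) = tCone F n (s n) :=
      ConcreteCategory.congr_hom (liftOmega1_tCone c hc n) PUnit.unit
    dsimp only at hs ⊢
    rw [rMap_eq_of_tCone_eq p h, ← hs n, rMap_comp, min_self]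

theorem exists_iCocone_eq (x : FOmega0 F) : ∃ n a, iCocone F n a = x :=
  Types.jointly_surjective' x

include p in
theorem uBar_injective : Function.Injective (uBar F) := by
  have key : ∀ n, uMap F n ≫ pMap F p n ≫ iCocone F (n + 1) = iCocone F n := fun n => by
    rw [← Category.assoc, uMap_pMap, iMap_iCocone]
  -- For large `m`, the map `i_(m+1) ∘ F^m p ∘ t_m` recovers an element of `F^ω 0` from its image
  -- under `ū`.
  have hrec : ∀ {n m} (a : F0 F n), n ≤ m →
      iCocone F n a = iCocone F (m + 1) (pMap F p m (tCone F m (uBar F (iCocone F n a)))) := by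
    intro n m a h
    obtain ⟨b, hb⟩ : ∃ b, iCocone F m b = iCocone F n a := by
      induction h with
      | refl => exact ⟨a, rfl⟩
      | step _ ih =>
        obtain ⟨b, hb⟩ := ih
        exact ⟨iMap F _ b, (ConcreteCategory.congr_hom (iMap_iCocone F _) b).trans hb⟩
    rw [← hb]
    have h1 := ConcreteCategory.congr_hom (iCocone_uBar_tCone F m m) b
    have h2 := ConcreteCategory.congr_hom (key m) b
    rw [cMap_self] at h1
    refine h2.symm.trans ?_
    exact congrArg (pMap F p m ≫ iCocone F (m + 1)) h1.symm
  intro x y hxy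
  obtain ⟨n, a, rfl⟩ := exists_iCocone_eq x
  obtain ⟨m, b, rfl⟩ := exists_iCocone_eq y
  rw [hrec a (le_max_left n m), hrec b (le_max_right n m), hxy]

theorem exists_uBar_eq_rMap (n : ℕ) (x : FOmega1 F) : ∃ a, uBar F a = rMap F p n x :=
  ⟨iCocone F (n + 1) (pMap F p n (tCone F n x)), rfl⟩

end Chains

/-! ### Initiality of `μF` -/

section Initial

variable (F : Type u ⥤ Type u)

/-- The morphisms `F^n 0 ⟶ A` induced by an algebra `A`. -/
def algCocone {F : Type u ⥤ Type u} (A : Algebra F) : (n : ℕ) → (F0 F n ⟶ A.a)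
  | 0 => ↾(fun x : PEmpty.{u + 1} => PEmpty.elim x)
  | n + 1 => F.map (algCocone A n) ≫ A.str

theorem iMap_algCocone {F : Type u ⥤ Type u} (A : Algebra F) :
    ∀ n, iMap F n ≫ algCocone A (n + 1) = algCocone A n
  | 0 => F0_zero_hom_ext F _ _
  | n + 1 => by
    change F.map (iMap F n) ≫ F.map (algCocone A (n + 1)) ≫ A.str = F.map (algCocone A n) ≫ A.str
    rw [← Category.assoc, ← F.map_comp, iMap_algCocone A n]

variable [PreservesFilteredColimits F]

theorem iCocone_phi_inv (n : ℕ) : iCocone F (n + 1) ≫ (phi F).inv = F.map (iCocone F n) :=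
  iCocone_descOmega0 (phiInvLeg F) (iMap_phiInvLeg F) (n + 1)

variable {F} in
theorem map_comp_eq_phi_comp_iff {A : Type u} (α : F.obj A ⟶ A) (g : FOmega0 F ⟶ A) :
    F.map g ≫ α = (phi F).hom ≫ g ↔ ∀ n, iCocone F n ≫ g = algCocone ⟨A, α⟩ n := by
  rw [← Iso.inv_comp_eq]
  have hstep (n : ℕ) : iCocone F (n + 1) ≫ (phi F).inv ≫ F.map g ≫ α =
      F.map (iCocone F n ≫ g) ≫ α := by
    rw [← Category.assoc, iCocone_phi_inv, F.map_comp]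
    rfl
  constructor
  · intro h n
    induction n with
    | zero => exact F0_zero_hom_ext F _ _
    | succ n ih =>
      rw [← h, hstep, ih]
      rfl
  · intro h
    refine FOmega0_hom_ext fun n => ?_
    cases n with
    | zero => exact F0_zero_hom_ext F _ _
    | succ n =>
      rw [hstep, h, h]
      rfl

/-- `(μF, φ)` is an initial algebra. -/
def muAlgIsInitial : IsInitial (muAlg F) :=
  IsInitial.ofUniqueHom
    (fun A =>
      { f := descOmega0 (algCocone A) (iMap_algCocone A)
        h := (map_comp_eq_phi_comp_iff A.str _).2 fun n => iCocone_descOmega0 _ _ n })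
    (fun A f => by
      ext1
      refine FOmega0_hom_ext fun n => ?_
      rw [iCocone_descOmega0]
      exact (map_comp_eq_phi_comp_iff A.str f.f).1 f.h n)

end Initial

/-! ### Finite supports and presentations of finitary functors -/

section Finitary

variable (F : Type u ⥤ Type u)

/-- The diagram of all finite subsets of a set. -/
def finsetDiagram (X : Type u) : Finset X ⥤ Type u where
  obj s := {x // x ∈ s}
  map h := ↾(fun x => ⟨x.1, leOfHom h x.2⟩)

/-- The inclusions of the finite subsets of `X`. -/
def finsetCocone (X : Type u) : Cocone (finsetDiagram X) where
  pt := X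
  ι := { app := fun s => ↾(Subtype.val : {x // x ∈ s} → X) }

open Classical in
/-- Every set is the filtered colimit of its finite subsets. -/
def finsetCoconeIsColimit (X : Type u) : IsColimit (finsetCocone X) :=
  Types.FilteredColimit.isColimitOf _ _
    (fun x => ⟨{x}, ⟨x, Finset.mem_singleton_self x⟩, rfl⟩)
    (fun s t _ _ h => ⟨s ∪ t, homOfLE Finset.subset_union_left, homOfLE Finset.subset_union_right,
      Subtype.ext h⟩)

variable {F}

theorem exists_finset_support [PreservesFilteredColimits F] {X : Type u} (z : F.obj X) :
    ∃ (s : Finset X) (y : F.obj {x // x ∈ s}), F.map (↾(Subtype.val : {x // x ∈ s} → X)) y = z :=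
  Types.jointly_surjective_of_isColimit
    (isColimitOfPreserves F (finsetCoconeIsColimit X)) z

theorem map_surjective_of_rightInverse {X Y : Type u} {f : X ⟶ Y} (g : Y → X)
    (h : ∀ y, f (g y) = y) :
    Function.Surjective (F.map f) := by
  have h1 : ↾g ≫ f = 𝟙 Y := by
    ext y
    exact h y
  intro y
  refine ⟨F.map (↾g) y, ?_⟩
  have h2 := ConcreteCategory.congr_hom (F.map_comp (↾g) f) y
  rw [h1, F.map_id] at h2
  exact h2.symm

theorem map_injective_of_injective {X Y : Type u} [Nonempty X] {f : X ⟶ Y}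
    (hf : Function.Injective f) : Function.Injective (F.map f) := by
  obtain ⟨g, hg⟩ := hf.hasLeftInverse
  have h1 : f ≫ ↾g = 𝟙 X := by
    ext x
    exact hg x
  intro x y hxy
  have h2 := F.map_comp f (↾g)
  rw [h1, F.map_id] at h2
  exact (ConcreteCategory.congr_hom h2 x).trans
    ((congrArg (F.map (↾g)) hxy).trans (ConcreteCategory.congr_hom h2 y).symm)

variable (F) in
/-- The canonical presentation: the operation symbols of arity `n` are the elements of
`F {0, …, n - 1}`. -/
def canonicalPresentation : polyFunctor (fun n => F.obj (ULift.{u} (Fin n))) ⟶ F where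
  app X := ↾(fun z => F.map (↾(fun i : ULift.{u} (Fin z.1.1) => z.2 i.down)) z.1.2)
  naturality X Y f := by
    ext ⟨⟨n, a⟩, g⟩
    exact ConcreteCategory.congr_hom (F.map_comp (↾(fun i : ULift.{u} (Fin n) => g i.down)) f) a

theorem isPresentation_canonicalPresentation [PreservesFilteredColimits F]
    : IsPresentation (canonicalPresentation F) := by
  intro X z
  obtain ⟨s, y, rfl⟩ := exists_finset_support z
  let e : {x // x ∈ s} ≃ Fin s.card := s.equivFin
  obtain ⟨a, rfl⟩ := map_surjective_of_rightInverse (F := F)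
    (f := ↾(fun i : ULift.{u} (Fin s.card) => e.symm i.down)) (fun y => ⟨e y⟩)
    (fun y => e.symm_apply_apply y) y
  exact ⟨⟨⟨s.card, a⟩, fun i => (e.symm i).1⟩,
    ConcreteCategory.congr_hom (F.map_comp (↾(fun i : ULift.{u} (Fin s.card) => e.symm i.down))
      (↾(Subtype.val : {x // x ∈ s} → X))) a⟩

/-! ### Existence of a terminal coalgebra -/

/-- A presentation makes `F` a quotient of a polynomial functor, in the universe-homogeneous form
that `QPF.Cofix` requires. -/
abbrev presentationQPF {S : ℕ → Type u} (ε : polyFunctor S ⟶ F) (hε : IsPresentation ε) :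
    QPF.{u, u, u} (fun X => F.obj X) where
  map f := F.map (↾f)
  P := ⟨Σ n, S n, fun a => ULift.{u} (Fin a.1)⟩
  abs {X} z := ε.app X ⟨z.1, fun i => z.2 ⟨i⟩⟩
  repr {X} z := ⟨(hε X z).choose.1, fun i => (hε X z).choose.2 i.down⟩
  abs_repr {X} z := (hε X z).choose_spec
  abs_map f z := ConcreteCategory.congr_hom (ε.naturality (↾f)) ⟨z.1, fun i => z.2 ⟨i⟩⟩

theorem exists_isTerminal_coalgebra {S : ℕ → Type u} (ε : polyFunctor S ⟶ F)
    (hε : IsPresentation ε) : ∃ C : Coalgebra F, Nonempty (IsTerminal C) := by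
  let _ : QPF.{u, u, u} (fun X => F.obj X) := presentationQPF ε hε
  let T := QPF.Cofix (fun X => F.obj X)
  refine ⟨⟨T, ↾(QPF.Cofix.dest (F := fun X => F.obj X) : T → F.obj T)⟩,
    ⟨IsTerminal.ofUniqueHom (fun A =>
      { f := ↾(QPF.Cofix.corec (F := fun X => F.obj X) (fun x : A.V => A.str x))
        h := ?_ }) fun A f => ?_⟩⟩
  · ext x
    exact (QPF.Cofix.dest_corec (F := fun X => F.obj X) (fun x : A.V => A.str x) x).symm
  · ext x
    let g := QPF.Cofix.corec (F := fun X => F.obj X) (fun x : A.V => A.str x)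
    refine QPF.Cofix.bisim_rel (F := fun X => F.obj X)
      (fun y y' => ∃ x, y = f.f x ∧ y' = g x) ?_ _ _ ⟨x, rfl, rfl⟩
    rintro _ _ ⟨x, rfl, rfl⟩
    set q : T → Quot (fun y y' => ∃ x, y = f.f x ∧ y' = g x) := Quot.mk _ with hq
    have h1 : QPF.Cofix.dest (F := fun X => F.obj X) (f.f x) = F.map f.f (A.str x) :=
      (ConcreteCategory.congr_hom f.h x).symm
    have h2 : QPF.Cofix.dest (F := fun X => F.obj X) (g x) = F.map (↾g) (A.str x) :=
      QPF.Cofix.dest_corec (F := fun X => F.obj X) (fun x : A.V => A.str x) x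
    have h3 : f.f ≫ ↾q = ↾g ≫ ↾q := by
      ext x
      exact Quot.sound ⟨x, rfl, rfl⟩
    rw [h1, h2]
    change (F.map f.f ≫ F.map (↾q)) (A.str x) = (F.map (↾g) ≫ F.map (↾q)) (A.str x)
    rw [← F.map_comp, ← F.map_comp, h3]

/-! ### The embedding of `νF` in `F^ω 1` -/

theorem tCone_eq_of_le {n m : ℕ} (h : n ≤ m) {x y : FOmega1 F}
    (hxy : tCone F m x = tCone F m y) : tCone F n x = tCone F n y := by
  induction h using Nat.decreasingInduction with
  | self => exact hxy
  | of_succ k _ ih =>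
    rw [← tCone_tMap]
    exact congrArg (tMap F k) ih

theorem exists_tCone_injOn (s : Finset (FOmega1 F)) : ∃ n, Set.InjOn (tCone F n) (s : Set _) := by
  have h : ∀ x y : FOmega1 F, ∃ n, tCone F n x = tCone F n y → x = y := fun x y => by
    by_contra! hne
    exact (hne 0).2 (FOmega1_ext fun n => (hne n).1)
  choose N hN using h
  refine ⟨(s ×ˢ s).sup fun q => N q.1 q.2, fun x hx y hy hxy => hN x y ?_⟩
  exact tCone_eq_of_le (Finset.le_sup (f := fun q : FOmega1 F × FOmega1 F => N q.1 q.2)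
    (Finset.mk_mem_product hx hy)) hxy

/-- As `F` is finitary, the canonical map from `F (F^ω 1)` to `F^ω 1`, the limit of the objects
`F (F^n 1)`, is injective: an element of `F (F^ω 1)` lives on a finite subset, and finite subsets
are embedded in some `F^n 1`. -/
theorem map_tCone_jointly_injective [PreservesFilteredColimits F] [Nonempty (FOmega1 F)]
    {z w : F.obj (FOmega1 F)}
    (h : ∀ n, F.map (tCone F n) z = F.map (tCone F n) w) : z = w := by
  classical
  obtain ⟨s, z', rfl⟩ := exists_finset_support z
  obtain ⟨t, w', rfl⟩ := exists_finset_support w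
  let a : FOmega1 F := Classical.arbitrary _
  let k : Finset (FOmega1 F) := insert a (s ∪ t)
  -- A nonempty `k` is required, since `F` need not preserve monomorphisms with empty domain.
  have : Nonempty {x // x ∈ k} := ⟨⟨a, Finset.mem_insert_self _ _⟩⟩
  let ik : {x // x ∈ k} ⟶ FOmega1 F := ↾Subtype.val
  have hlift : ∀ s : Finset (FOmega1 F), s ⊆ k → ∀ z : F.obj {x // x ∈ s},
      ∃ z', F.map (↾(Subtype.val : {x // x ∈ s} → FOmega1 F)) z = F.map ik z' := by
    intro s hs z
    exact ⟨F.map (↾(fun x : {x // x ∈ s} => (⟨x.1, hs x.2⟩ : {x // x ∈ k}))) z,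
      ConcreteCategory.congr_hom
        (F.map_comp (↾(fun x : {x // x ∈ s} => (⟨x.1, hs x.2⟩ : {x // x ∈ k}))) ik) z⟩
  obtain ⟨z1, hz1⟩ := hlift s (Finset.subset_union_left.trans (Finset.subset_insert _ _)) z'
  obtain ⟨w1, hw1⟩ := hlift t (Finset.subset_union_right.trans (Finset.subset_insert _ _)) w'
  rw [hz1, hw1] at h ⊢
  obtain ⟨n, hn⟩ := exists_tCone_injOn k
  have hinj : Function.Injective (ik ≫ tCone F n) := fun x y hxy =>
    Subtype.ext (hn x.2 y.2 hxy)
  congr 1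
  refine map_injective_of_injective (F := F) hinj ?_
  rw [F.map_comp]
  exact h n

theorem toOmega1_tCone (C : Coalgebra F) (n : ℕ) : toOmega1 C ≫ tCone F n = coalgCone C n :=
  liftOmega1_tCone _ _ n

theorem tCone_toOmega1_apply (C : Coalgebra F) (n : ℕ) (x : C.V) :
    tCone F n (toOmega1 C x) = coalgCone C n x :=
  ConcreteCategory.congr_hom (toOmega1_tCone C n) x

theorem coalgCone_hom {C D : Coalgebra F} (f : C ⟶ D) :
    ∀ n, f.f ≫ coalgCone D n = coalgCone C n
  | 0 => F1_zero_hom_ext F _ _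
  | n + 1 => by
    change f.f ≫ D.str ≫ F.map (coalgCone D n) = C.str ≫ F.map (coalgCone C n)
    rw [← Category.assoc, ← f.h, Category.assoc, ← F.map_comp, coalgCone_hom f n]

theorem toOmega1_hom {C D : Coalgebra F} (f : C ⟶ D) : f.f ≫ toOmega1 D = toOmega1 C :=
  FOmega1_hom_ext fun n => by
    rw [Category.assoc, toOmega1_tCone, toOmega1_tCone, coalgCone_hom]

theorem toOmega1_hom_apply {C D : Coalgebra F} (f : C ⟶ D) (x : C.V) :
    toOmega1 D (f.f x) = toOmega1 C x :=
  ConcreteCategory.congr_hom (toOmega1_hom f) x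

/-- The kernel of `j` is a congruence of coalgebras. -/
theorem map_toOmega1_str_eq [PreservesFilteredColimits F] (C : Coalgebra F) {x y : C.V}
    (h : toOmega1 C x = toOmega1 C y) :
    F.map (toOmega1 C) (C.str x) = F.map (toOmega1 C) (C.str y) := by
  have : Nonempty (FOmega1 F) := ⟨toOmega1 C x⟩
  refine map_tCone_jointly_injective fun n => ?_
  have key : ∀ x, F.map (tCone F n) (F.map (toOmega1 C) (C.str x)) =
      tCone F (n + 1) (toOmega1 C x) := fun x => by
    rw [tCone_toOmega1_apply]
    change (F.map (toOmega1 C) ≫ F.map (tCone F n)) (C.str x) = F.map (coalgCone C n) (C.str x)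
    rw [← F.map_comp, toOmega1_tCone]
  rw [key, key, h]

/-- For a terminal coalgebra `j` is injective: choosing a representative in every class of the
kernel of `j` yields a homomorphism `e` from `νF` to another coalgebra on the same set, which has a
left inverse by terminality. -/
theorem toOmega1_injective [PreservesFilteredColimits F] {C : Coalgebra F} (hC : IsTerminal C) :
    Function.Injective (toOmega1 C) := by
  intro x y hxy
  have : Nonempty C.V := ⟨x⟩
  let s : FOmega1 F ⟶ C.V := ↾(Function.invFun (toOmega1 C))
  have hs : ∀ x, toOmega1 C (s (toOmega1 C x)) = toOmega1 C x := fun x =>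
    Function.invFun_eq ⟨x, rfl⟩
  let e : C.V ⟶ C.V := toOmega1 C ≫ s
  let D : Coalgebra F := ⟨C.V, C.str ≫ F.map e⟩
  let f : C ⟶ D :=
    { f := e
      h := by
        ext x
        change F.map e (C.str x) = F.map e (C.str (e x))
        change F.map (toOmega1 C ≫ s) _ = F.map (toOmega1 C ≫ s) _
        rw [F.map_comp]
        exact congrArg (F.map s) (map_toOmega1_str_eq C (hs x).symm) }
  have hf : f ≫ hC.from D = 𝟙 C := hC.hom_ext _ _
  have hf' : ∀ x, (hC.from D).f (e x) = x := fun x =>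
    ConcreteCategory.congr_hom (congrArg Coalgebra.Hom.f hf) x
  rw [← hf' x, ← hf' y]
  exact congrArg (fun v => (hC.from D).f (s v)) hxy

theorem toOmega1_muCoalg [PreservesFilteredColimits F] : toOmega1 (muCoalg F) = uBar F := by
  refine (existsUnique_uBar F).unique (fun n => ?_) (existsUnique_uBar F).choose_spec.1
  refine (congrArg (iCocone F n ≫ ·) (toOmega1_tCone (muCoalg F) n)).trans ?_
  induction n with
  | zero => exact F0_zero_hom_ext F _ _
  | succ n ih =>
    change iCocone F (n + 1) ≫ (phi F).inv ≫ F.map (coalgCone (muCoalg F) n) = F.map (uMap F n)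
    rw [← ih, ← Category.assoc, iCocone_phi_inv]
    exact (F.map_comp (iCocone F n) (coalgCone (muCoalg F) n)).symm

theorem toOmega1_mMap [PreservesFilteredColimits F] {C : Coalgebra F} (hC : IsTerminal C)
    (a : FOmega0 F) :
    toOmega1 C (mMap hC a) = uBar F a := by
  rw [← toOmega1_muCoalg]
  exact toOmega1_hom_apply (hC.from (muCoalg F)) a

end Finitary

/-! ### Trees modulo the `ε`-equations -/

section Trees

variable {F : Type u ⥤ Type u} {S : ℕ → Type u}

theorem app_map (ε : polyFunctor S ⟶ F) {X Y : Type u} (f : X → Y)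
    (a : (sigP S).Obj X) : ε.app Y ((sigP S).map f a) = F.map (↾f) (ε.app X a) :=
  ConcreteCategory.congr_hom (ε.naturality (↾f)) a

/-- The evaluation of finite trees in the `H_S`-algebra `φ ∘ ε` on `μF`. -/
def evalFin [PreservesFilteredColimits F] (ε : polyFunctor S ⟶ F) : FinTree S → FOmega0 F
  | ⟨a, f⟩ => (phi F).hom (ε.app (FOmega0 F) ⟨a, fun i => evalFin ε (f i)⟩)

theorem evalFin_mk [PreservesFilteredColimits F] (ε : polyFunctor S ⟶ F)
    (a : (sigP S).Obj (FinTree S)) :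
    evalFin ε (PFunctor.W.mk a) = (phi F).hom (ε.app _ ((sigP S).map (evalFin ε) a)) := rfl

theorem evalFin_eq_of_epsEq [PreservesFilteredColimits F] (ε : polyFunctor S ⟶ F)
    {s t : FinTree S} (h : EpsEq ε s t) :
    evalFin ε s = evalFin ε t := by
  induction h with
  | eqn X a b h f =>
    rw [evalFin_mk, evalFin_mk, PFunctor.map_map, PFunctor.map_map, app_map, app_map, h]
  | congr a f g _ ih =>
    change (phi F).hom (ε.app _ ⟨a, fun i => evalFin ε (f i)⟩) =
      (phi F).hom (ε.app _ ⟨a, fun i => evalFin ε (g i)⟩)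
    rw [funext ih]
  | refl => rfl
  | symm _ ih => exact ih.symm
  | trans _ _ ih1 ih2 => exact ih1.trans ih2

/-- The finite trees modulo `∼` form the initial algebra: `∼` is the kernel of evaluation in `μF`.
The quotient by `∼` is an `F`-algebra because the operation on representatives respects the
`ε`-equations; the quotient map factors through evaluation by initiality of `μF`. -/
theorem epsEq_iff_evalFin_eq [PreservesFilteredColimits F] {ε : polyFunctor S ⟶ F}
    (hε : IsPresentation ε) {s t : FinTree S} :
    EpsEq ε s t ↔ evalFin ε s = evalFin ε t := by
  refine ⟨evalFin_eq_of_epsEq ε, fun hst => ?_⟩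
  let R : Setoid (FinTree S) := ⟨EpsEq ε, EpsEq.refl, EpsEq.symm, EpsEq.trans⟩
  let Q : Type u := Quotient R
  let α : F.obj Q ⟶ Q := ↾(fun z =>
    Quotient.mk R (PFunctor.W.mk ((sigP S).map Quotient.out (hε Q z).choose)))
  have hα : ∀ a : (sigP S).Obj (FinTree S),
      α (ε.app Q ((sigP S).map (Quotient.mk R) a)) = Quotient.mk R (PFunctor.W.mk a) := by
    intro a
    refine Quotient.sound (EpsEq.trans (EpsEq.eqn Q _ _ (hε Q _).choose_spec Quotient.out) ?_)
    obtain ⟨a, f⟩ := a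
    exact EpsEq.congr a _ _ fun i => Quotient.mk_out (s := R) (f i)
  let k : muAlg F ⟶ ⟨Q, α⟩ := (muAlgIsInitial F).to _
  have hk : ∀ s, k.f (evalFin ε s) = Quotient.mk R s := by
    intro s
    induction s with
    | mk a f ih =>
      have h1 : k.f ((phi F).hom (ε.app _ ⟨a, fun i => evalFin ε (f i)⟩)) =
          α (F.map k.f (ε.app _ ⟨a, fun i => evalFin ε (f i)⟩)) :=
        (ConcreteCategory.congr_hom k.h _).symm
      refine h1.trans ?_
      have h2 := app_map ε (fun x => k.f x) (⟨a, fun i => evalFin ε (f i)⟩ : (sigP S).Obj _)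
      refine (congrArg α h2.symm).trans ?_
      refine Eq.trans ?_ (hα ⟨a, f⟩)
      congr 2
      exact Sigma.ext rfl (heq_of_eq (funext ih))
  refine Quotient.exact (s := R) ?_
  rw [← hk s, ← hk t, hst]

/-- Cutting a tree at height `n` amounts to applying `i_(n+1) ∘ F^n p` to its image in `F^n 1`. -/
theorem evalFin_cut [PreservesFilteredColimits F] (ε : polyFunctor S ⟶ F) (p' : S 0)
    {p : F.obj PEmpty.{u + 1}}
    (hp : ε.app PEmpty.{u + 1} (constTerm p' _) = p)
    (n : ℕ) (s : STree S) :
    evalFin ε (cut p' n s) =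
      iCocone F (n + 1) (pMap F p n (coalgCone (treeCoalg ε) n s)) := by
  have hphi : ∀ n (z : F.obj (F0 F n)), (phi F).hom (F.map (iCocone F n) z) = iCocone F (n + 1) z :=
    fun n z => ConcreteCategory.congr_hom (map_iCocone_phiHom F n) z
  induction n generalizing s with
  | zero =>
    subst hp
    refine Eq.trans ?_ (hphi 0 _)
    have h := app_map ε (fun x => iCocone F 0 x) (constTerm p' PEmpty.{u + 1})
    refine Eq.trans ?_ (congrArg (phi F).hom h)
    change (phi F).hom _ = _
    congr 2
    exact Sigma.ext rfl (heq_of_eq (funext fun i => Fin.elim0 i))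
  | succ n ih =>
    let g : STree S ⟶ F0 F (n + 1) := coalgCone (treeCoalg ε) n ≫ pMap F p n
    refine Eq.trans ?_ (hphi (n + 1) _)
    have h1 : pMap F p (n + 1) (coalgCone (treeCoalg ε) (n + 1) s) =
        F.map g (ε.app (STree S) s.dest) :=
      (ConcreteCategory.congr_hom (F.map_comp (coalgCone (treeCoalg ε) n) (pMap F p n))
        (ε.app (STree S) s.dest)).symm
    have h2 := app_map ε (fun x => iCocone F (n + 1) (g x)) s.dest
    have h3 := ConcreteCategory.congr_hom (F.map_comp g (iCocone F (n + 1)))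
      (ε.app (STree S) s.dest)
    refine Eq.trans ?_ (congrArg (fun z => (phi F).hom (F.map (iCocone F (n + 1)) z)) h1.symm)
    refine Eq.trans ?_ (congrArg (phi F).hom (h2.trans h3))
    change (phi F).hom _ = _
    congr 2
    exact Sigma.ext rfl (heq_of_eq (funext fun i => ih _))

variable {C : Coalgebra F} (hC : IsTerminal C)

theorem toOmega1_kHat (ε : polyFunctor S ⟶ F) (s : STree S) :
    toOmega1 C (kHat ε hC s) = toOmega1 (treeCoalg ε) s :=
  toOmega1_hom_apply (hC.from (treeCoalg ε)) s

theorem uBar_evalFin_cut [PreservesFilteredColimits F] (ε : polyFunctor S ⟶ F) (p' : S 0)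
    {p : F.obj PEmpty.{u + 1}}
    (hp : ε.app PEmpty.{u + 1} (constTerm p' _) = p)
    (n : ℕ) (s : STree S) :
    uBar F (evalFin ε (cut p' n s)) = rMap F p n (toOmega1 C (kHat ε hC s)) := by
  have h := tCone_toOmega1_apply (treeCoalg ε) n s
  rw [evalFin_cut ε p' hp, toOmega1_kHat, ← h]
  rfl

theorem kHat_surjective {ε : polyFunctor S ⟶ F} (hε : IsPresentation ε) :
    Function.Surjective (kHat ε hC) := by
  -- A section of `ε` turns `C` into an `H_S`-coalgebra, which unfolds to trees.
  choose σ hσ using fun x : C.V => hε C.V (C.str x)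
  let g : C ⟶ treeCoalg ε :=
    { f := ↾(PFunctor.M.corec σ)
      h := by
        ext x
        refine Eq.trans ?_ (congrArg (ε.app (STree S)) (PFunctor.M.dest_corec σ x)).symm
        refine Eq.trans ?_ (app_map ε (PFunctor.M.corec σ) (σ x)).symm
        exact congrArg (F.map (↾(PFunctor.M.corec σ))) (hσ x).symm }
  have h : g ≫ hC.from (treeCoalg ε) = 𝟙 C := hC.hom_ext _ _
  exact fun x => ⟨g.f x, ConcreteCategory.congr_hom (congrArg Coalgebra.Hom.f h) x⟩

include hC in
theorem str_injective : Function.Injective C.str := fun x y h => by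
  have hinv : ∀ x, Coalgebra.Terminal.strInv hC (C.str x) = x := fun x =>
    ConcreteCategory.congr_hom (Coalgebra.Terminal.right_inv hC) x
  rw [← hinv x, h, hinv]

theorem str_mMap [PreservesFilteredColimits F] (a : FOmega0 F) :
    C.str (mMap hC a) = F.map (mMap hC) ((phi F).inv a) :=
  (ConcreteCategory.congr_hom (hC.from (muCoalg F)).h a).symm

theorem kHat_toTree [PreservesFilteredColimits F] (ε : polyFunctor S ⟶ F) (s : FinTree S) :
    kHat ε hC s.toTree = mMap hC (evalFin ε s) := by
  induction s with
  | mk a f ih =>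
    refine str_injective hC ?_
    rw [str_mMap]
    have h1 : C.str (kHat ε hC (FinTree.toTree ⟨a, f⟩)) =
        F.map (kHat ε hC) (ε.app _ ⟨a, fun i => FinTree.toTree (f i)⟩) :=
      (ConcreteCategory.congr_hom (hC.from (treeCoalg ε)).h _).symm
    have h2 : (phi F).inv (evalFin ε ⟨a, f⟩) = ε.app _ ⟨a, fun i => evalFin ε (f i)⟩ :=
      ConcreteCategory.congr_hom (phi F).hom_inv_id _
    rw [h1, h2]
    have h3 := app_map ε (fun x => kHat ε hC x) ⟨a, fun i => FinTree.toTree (f i)⟩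
    have h4 := app_map ε (fun x => mMap hC x) ⟨a, fun i => evalFin ε (f i)⟩
    refine (h3.symm.trans ?_).trans h4
    congr 1
    exact Sigma.ext rfl (heq_of_eq (funext ih))

theorem kHat_eq_iff [PreservesFilteredColimits F] {ε : polyFunctor S ⟶ F} (hε : IsPresentation ε)
    (p' : S 0) (s s' : STree S) :
    kHat ε hC s = kHat ε hC s' ↔ EpsEqStar ε p' s s' := by
  obtain ⟨p, hp⟩ : ∃ p, ε.app PEmpty.{u + 1} (constTerm p' _) = p := ⟨_, rfl⟩
  have key : ∀ n, EpsEq ε (cut p' n s) (cut p' n s') ↔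
      tCone F n (toOmega1 C (kHat ε hC s)) = tCone F n (toOmega1 C (kHat ε hC s')) := fun n => by
    rw [epsEq_iff_evalFin_eq hε, ← (uBar_injective p).eq_iff, uBar_evalFin_cut hC ε p' hp,
      uBar_evalFin_cut hC ε p' hp, rMap_eq_iff]
  refine ⟨fun h n => (key n).2 (by rw [h]), fun h => ?_⟩
  exact toOmega1_injective hC (FOmega1_ext fun n => (key n).1 (h n))

theorem cutLE_iff_chainLE [PreservesFilteredColimits F] {ε : polyFunctor S ⟶ F}
    (hε : IsPresentation ε) (p' : S 0)
    {p : F.obj PEmpty.{u + 1}} (hp : ε.app PEmpty.{u + 1} (constTerm p' _) = p)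
    (x y : C.V) :
    CutLE ε p' hC x y ↔ ChainLE F p (toOmega1 C x) (toOmega1 C y) := by
  refine or_congr (toOmega1_injective hC).eq_iff.symm ?_
  constructor
  · rintro ⟨s, s', n, rfl, rfl, h⟩
    refine ⟨n, ?_⟩
    rw [kHat_toTree, toOmega1_mMap, evalFin_eq_of_epsEq ε h, uBar_evalFin_cut hC ε p' hp]
  · rintro ⟨n, h⟩
    obtain ⟨s', rfl⟩ := kHat_surjective hC hε y
    refine ⟨cut p' n s', s', n, ?_, rfl, EpsEq.refl _⟩
    refine toOmega1_injective hC ?_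
    rw [h, kHat_toTree, toOmega1_mMap, uBar_evalFin_cut hC ε p' hp]

end Trees

end CuttingOrder

end

theorem theoremT (F : Type u ⥤ Type u) [PreservesFilteredColimits F] (p : F.obj PEmpty.{u + 1}) :
    -- the objects exist
    Nonempty (IsInitial (muAlg F)) ∧
    (∃ C : Coalgebra F, Nonempty (IsTerminal C)) ∧
    (∃ (S : ℕ → Type u) (ε : polyFunctor S ⟶ F), IsPresentation ε) ∧
    -- for every presentation, nullary symbol over `p`, and terminal coalgebra:
    ∀ (S : ℕ → Type u) (ε : polyFunctor S ⟶ F), IsPresentation ε →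
    ∀ p' : S 0, ε.app PEmpty.{u + 1} (constTerm p' PEmpty.{u + 1}) = p →
    ∀ (C : Coalgebra F) (hC : IsTerminal C),
      -- `νF` is the quotient of the trees modulo `∼*`
      Function.Surjective (kHat ε hC) ∧
      (∀ s s' : STree S, kHat ε hC s = kHat ε hC s' ↔ EpsEqStar ε p' s s') ∧
      -- the relations in question are partial orders, on `F^ω 1`, `νF`, `μF`, `F(νF)`, `F(μF)`
      ∃ (_oOmega : PartialOrder (FOmega1 F)) (_oNu : PartialOrder C.V)
        (_oMu : PartialOrder (FOmega0 F)) (_oFNu : PartialOrder (F.obj C.V))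
        (_oFMu : PartialOrder (F.obj (FOmega0 F))),
        (∀ x y : FOmega1 F, x ≤ y ↔ ChainLE F p x y) ∧
        (∀ x y : C.V, x ≤ y ↔ CutLE ε p' hC x y) ∧
        (∀ a b : FOmega0 F, a ≤ b ↔ mMap hC a ≤ mMap hC b) ∧
        (∀ z w : F.obj C.V,
          z ≤ w ↔ Coalgebra.Terminal.strInv hC z ≤ Coalgebra.Terminal.strInv hC w) ∧
        (∀ z w : F.obj (FOmega0 F), z ≤ w ↔ (phi F).hom z ≤ (phi F).hom w) ∧
        -- the order by cutting coincides with the order of `F^ω 1` restricted to `νF`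
        Function.Injective (toOmega1 C) ∧
        (∀ x y : C.V, x ≤ y ↔ toOmega1 C x ≤ toOmega1 C y) ∧
        -- `F^ω 1` is a conservative completion of `νF` and of its subposet `μF`
        (∀ a : FOmega0 F, toOmega1 C (mMap hC a) = uBar F a) ∧
        IsConservativeCompletion.{v} (toOmega1 C) ∧
        IsConservativeCompletion.{v} (uBar F) ∧
        -- `F(μF)` is a subposet of `F(νF)`, and `φ⁻¹` is continuous
        (∀ z w : F.obj (FOmega0 F), F.map (mMap hC) z ≤ F.map (mMap hC) w ↔ z ≤ w) ∧
        ScottContinuous ((phi F).inv : FOmega0 F → F.obj (FOmega0 F)) ∧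
        -- `τ` is the unique continuous extension of `φ⁻¹`
        ScottContinuous (C.str : C.V → F.obj C.V) ∧
        (∀ a : FOmega0 F, C.str (mMap hC a) = F.map (mMap hC) ((phi F).inv a)) ∧
        ∀ g : C.V → F.obj C.V, ScottContinuous g →
          (∀ a : FOmega0 F, g (mMap hC a) = F.map (mMap hC) ((phi F).inv a)) →
          g = C.str := by
  refine ⟨⟨muAlgIsInitial F⟩,
    exists_isTerminal_coalgebra _ (isPresentation_canonicalPresentation (F := F)),
    ⟨_, _, isPresentation_canonicalPresentation⟩, ?_⟩
  intro S ε hε p' hp C hC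
  refine ⟨kHat_surjective hC hε, kHat_eq_iff hC hε p', ?_⟩
  have hr := isTruncation_rMap F p
  have hj := toOmega1_injective hC
  have hjm := toOmega1_mMap hC
  have hu := uBar_injective (F := F) p
  have hm : Function.Injective (mMap hC) := fun a b h => hu (by rw [← hjm, h, hjm])
  let φ : F.obj (FOmega0 F) ≃ FOmega0 F := (phi F).toEquiv
  let τ : C.V ≃ F.obj C.V :=
    ⟨C.str, Coalgebra.Terminal.strInv hC,
      fun x => ConcreteCategory.congr_hom (Coalgebra.Terminal.right_inv hC) x,
      fun x => ConcreteCategory.congr_hom (Coalgebra.Terminal.left_inv hC) x⟩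
  let oOmega : PartialOrder (FOmega1 F) := hr.partialOrder
  let oNu : PartialOrder C.V := PartialOrder.lift (toOmega1 C) hj
  let oMu : PartialOrder (FOmega0 F) := PartialOrder.lift (mMap hC) hm
  let oFNu : PartialOrder (F.obj C.V) := PartialOrder.lift τ.symm τ.symm.injective
  let oFMu : PartialOrder (F.obj (FOmega0 F)) := PartialOrder.lift φ φ.injective
  have hle : ∀ x y : FOmega1 F, x ≤ y ↔ x = y ∨ ∃ n, x = rMap F p n y := fun _ _ => Iff.rfl
  have hjle : ∀ x y : C.V, toOmega1 C x ≤ toOmega1 C y ↔ x ≤ y := fun _ _ => Iff.rfl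
  have hule : ∀ a b : FOmega0 F, uBar F a ≤ uBar F b ↔ a ≤ b := fun a b => by
    rw [← hjm, ← hjm]
    rfl
  have hτm : ∀ z, τ.symm (F.map (mMap hC) z) = mMap hC (φ z) := fun z => by
    rw [Equiv.symm_apply_eq]
    refine Eq.trans ?_ (str_mMap hC _).symm
    exact congrArg (F.map (mMap hC)) (φ.symm_apply_apply z).symm
  have hτ : ScottContinuous C.str := scottContinuous_of_equiv τ fun _ _ => Iff.rfl
  have hex : ∀ n x, ∃ a, toOmega1 C (mMap hC a) = rMap F p n x := fun n x => by
    obtain ⟨a, ha⟩ := exists_uBar_eq_rMap p n x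
    exact ⟨a, (hjm a).trans ha⟩
  refine ⟨oOmega, oNu, oMu, oFNu, oFMu, fun _ _ => Iff.rfl,
    fun x y => (cutLE_iff_chainLE hC hε p' hp x y).symm, fun _ _ => Iff.rfl, fun _ _ => Iff.rfl,
    fun _ _ => Iff.rfl, hj, fun _ _ => Iff.rfl, hjm, ?_, ?_, ?_, ?_, hτ, str_mMap hC, ?_⟩
  · refine isConservativeCompletion_of_trunc hr hle hjle fun n x => ?_
    obtain ⟨a, ha⟩ := hex n x
    exact ⟨_, ha⟩
  · exact isConservativeCompletion_of_trunc hr hle hule fun n x => exists_uBar_eq_rMap p n x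
  · intro z w
    change τ.symm _ ≤ τ.symm _ ↔ _
    rw [hτm, hτm]
    rfl
  · exact scottContinuous_of_equiv φ.symm fun _ _ => Iff.rfl
  · intro g hg hgm
    exact scottContinuous_ext hr hle hjle hex hg hτ fun a => (hgm a).trans (str_mMap hC a).symm
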